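/- **Setting.** Let $f:\mathbb R^n\times\mathbb R^m\times\mathbb R^q\to\mathbb R^n$, $\pi:\mathbb R^n\times\mathbb R^m\to\mathbb R^m$, put $f_\pi(x,v,w)=f(x,\pi(x,v),w)$, and let $\mathbb Z\subseteq\mathbb R^n\times\mathbb R^m$ and $\mathbb W\subseteq\mathbb R^q$ be compact and convex with nonempty interior, $0\in\operatorname{int}\mathbb W$. Let $\mathbb Z_\pi=\{(x,v):(x,\pi(x,v))\in\mathbb Z\}$. Let $\Omega\subseteq\mathbb R^n$ be a compact robust control invariant set: if $x-z\in\Omega$, $(x,v)\in\mathbb Z_\pi$, $w\in\mathbb W$, then $f_\pi(x,v,w)-f_\pi(z,v,0)\in\Omega$. Let $\overline{\mathbb Z}=\{(z,v):(z+\epsilon,v)\in\mathbb Z_\pi\ \forall\epsilon\in\Omega\}$; assume that $\Omega$ and $\overline{\mathbb Z}$ have nonempty interior and that $\overline{\mathbb Z}\subseteq\mathbb Z_\pi$ (automatic if $0\in\Omega$). Let $L:\mathbb R^n\times\mathbb R^m\to\mathbb R$ be continuous, $L_\pi(x,v)=L(x,\pi(x,v))$, and let $\ell$ be one of $L_\pi(z,v)$,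 $\int_\Omega L_\pi(z+\epsilon,v)\,d\epsilon$, $\max_{\epsilon\in\Omega}L_\pi(z+\epsilon,v)$ (read as a supremum if it is not attained). Assume that $\ell$ is Lipschitz on $\mathbb Z_\pi$. Call $(z(\cdot),v(\cdot))$ admissible over a horizon $N\in\mathbb N\cup\{\infty\}$ if $z(t+1)=f_\pi(z(t),v(t),0)$ and $(z(t),v(t))\in\overline{\mathbb Z}$ for all $0\le t<N$. Let $\mathbb X_\infty$ be the set of initial states $z(0)$ of trajectories admissible over the infinite horizon. Let $(z_s,v_s)$ minimize $\ell$ over all $(z,v)\in\overline{\mathbb Z}$ with $z=f_\pi(z,v,0)$, and put $\bar\ell=\ell-\ell(z_s,v_s)$ (so $\bar\ell=\ell$ under the usual normalization $\ell(z_s,v_s)=0$). Let $J_N=\sum_{t=0}^{N-1}\bar\ell(z(t),v(t))$, let $J_\infty=\limsup_{N\to\infty}J_N$, and let $V_N(z_0)$, $V_\infty(z_0)$ be the infima of $J_N$, $J_\infty$ over the pairs with $z(0)=z_0$ that are admissible over the respective horizon ($+\infty$ if there is none). A *closed-loop nominal sequence* with prediction horizon $N\ge1$ up to time $T$ consists of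 $z_N(0|0),\dots,z_N(0|T)$ and $v_N(0|0),\dots,v_N(0|T-1)$ such that for every $t<T$: $v_N(0|t)$ is the first element of an input sequence that attains $V_N(z_N(0|t))$; and, for some $x^+\in\{f_\pi(z_N(0|t),v_N(0|t),0)\}\oplus\Omega$, the state $z_N(0|t+1)$ minimizes $V_N(z_0)$ over all $z_0$ with $x^+\in\{z_0\}\oplus\Omega$, with finite minimum. Its cost is $J^{\rm cl}_T(z_N(0|0))=\sum_{t=0}^{T-1}\bar\ell(z_N(0|t),v_N(0|t))$. Let $\mathcal K_\infty$ be the class of continuous, strictly increasing, unbounded functions $\alpha:\mathbb R_{\ge0}\to\mathbb R_{\ge0}$ with $\alpha(0)=0$, and $\mathcal L$ the class of continuous, strictly decreasing functions $\delta:\mathbb R_{\ge0}\to\mathbb R_{\ge0}$ with $\delta(t)\to0$ as $t\to\infty$. **Assumptions.** 1. $(z_s,v_s)\in\operatorname{int}\overline{\mathbb Z}$. 2. (Exponential reachability) There are $C\ge0$ and $r\in[0,1)$ such that from every $z_0\in\mathbb X_\infty$ there starts a trajectory, admissible over the infinite horizon, with $\|(z(k),v(k))-(z_s,v_s)\|\le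 Cr^k$ for all $k$. 3. (Local $M$-step controllability, for some $M\in\mathbb N$) For every $\epsilon>0$ there is $\delta>0$ such that any $y,y'$ with $\|y-z_s\|,\|y'-z_s\|<\delta$ are joined by a nominal trajectory $z(t+1)=f_\pi(z(t),v(t),0)$, $z(0)=y$, $z(M)=y'$, whose states and inputs stay $\epsilon$-close to $z_s$ and $v_s$, respectively. 4. (Strict dissipativity) There are $\alpha_\ell\in\mathcal K_\infty$ and a bounded $\lambda:\mathbb R^n\to\mathbb R$ with $\lambda(f_\pi(z,v,0))-\lambda(z)\le\bar\ell(z,v)-\alpha_\ell(\|(z,v)-(z_s,v_s)\|)$ for all $(z,v)\in\overline{\mathbb Z}$. 5. There is $\alpha_V\in\mathcal K_\infty$ with $|V_N(z)-V_N(z_s)|\le\alpha_V(\|z-z_s\|)$ for all $N\in\mathbb N$ and $z\in\mathbb X_\infty$. **Theorem.** $V_\infty$ is finite on $\mathbb X_\infty$, and there is $\delta_3\in\mathcal L$ such that for all integers $N\ge1$, $T\ge0$ and every closed-loop nominal sequence with prediction horizon $N$ up to time $T$, with $z_N(0|0)\in\mathbb X_\infty$ and $z_N(0|T)\in\mathbb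 X_\infty$, $$J^{\rm cl}_T(z_N(0|0))\le V_\infty(z_N(0|0))-V_\infty(z_N(0|T))+T\,\delta_3(N).$$ Moreover, there is $N_0$ such that for all $N\ge N_0$ every closed-loop nominal sequence with $z_N(0|0)\in\mathbb X_\infty$ stays in $\mathbb X_\infty$, so that for $N\ge N_0$ the condition $z_N(0|T)\in\mathbb X_\infty$ holds automatically. -/

import Mathlib

open Filter Topology MeasureTheory
open scoped NNReal

namespace TubeEMPC

/-- The space `ℝⁿ`. -/
abbrev Vec (n : ℕ) : Type := EuclideanSpace ℝ (Fin n)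

/-! ### Comparison functions -/

/-- Class `𝓚_∞`: continuous, strictly increasing, zero at zero, unbounded. -/
def IsClassKInf (α : ℝ≥0 → ℝ≥0) : Prop :=
  Continuous α ∧ StrictMono α ∧ α 0 = 0 ∧ ∀ C : ℝ≥0, ∃ r : ℝ≥0, C < α r

/-- Class `𝓛`: continuous, strictly decreasing, tending to zero at infinity. -/
def IsClassL (δ : ℝ≥0 → ℝ≥0) : Prop :=
  Continuous δ ∧ StrictAnti δ ∧ Tendsto δ atTop (𝓝 0)

/-! ### The uncertain system, its feedback parametrization and the tube -/

/-- The raw data of the problem: dynamics `f`, parametrized feedback `π`, cost `L`, state-input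
constraint set `Z`, disturbance set `W`, and the set `Ω` used as cross section of the tube. -/
structure Data (n m q : ℕ) where
  f : Vec n → Vec m → Vec q → Vec n
  π : Vec n → Vec m → Vec m
  L : Vec n × Vec m → ℝ
  Z : Set (Vec n × Vec m)
  W : Set (Vec q)
  Ω : Set (Vec n)

namespace Data

variable {n m q : ℕ}

/-- `f_π(x,v,w) = f(x,π(x,v),w)`. -/
def fπ (S : Data n m q) (x : Vec n) (v : Vec m) (w : Vec q) : Vec n := S.f x (S.π x v) w

/-- The nominal dynamics `(z,v) ↦ f_π(z,v,0)`. -/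
def F (S : Data n m q) (z : Vec n) (v : Vec m) : Vec n := S.fπ z v 0

/-- `ℤ_π = {(x,v) | (x,π(x,v)) ∈ ℤ}`. -/
def Zπ (S : Data n m q) : Set (Vec n × Vec m) := {p | (p.1, S.π p.1 p.2) ∈ S.Z}

/-- The tightened constraint set `{(z,v) | (z+ε,v) ∈ ℤ_π for all ε ∈ Ω}`. -/
def Zbar (S : Data n m q) : Set (Vec n × Vec m) := {p | ∀ ε ∈ S.Ω, (p.1 + ε, p.2) ∈ S.Zπ}

/-- `Ω` is robust control invariant for the error system (under the feedback `π`). -/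
def IsRCI (S : Data n m q) : Prop :=
  IsCompact S.Ω ∧
    ∀ (x z : Vec n) (v : Vec m), x - z ∈ S.Ω → (x, v) ∈ S.Zπ →
      ∀ w ∈ S.W, S.fπ x v w - S.fπ z v 0 ∈ S.Ω

/-- `L_π(x,v) = L(x,π(x,v))`. -/
def Lπ (S : Data n m q) (p : Vec n × Vec m) : ℝ := S.L (p.1, S.π p.1 p.2)

/-- The averaged stage cost `∫_Ω L_π(z+ε,v) dε`. -/
noncomputable def Lint (S : Data n m q) (p : Vec n × Vec m) : ℝ :=
  ∫ ε in S.Ω, S.Lπ (p.1 + ε, p.2)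

/-- The worst-case stage cost `max_{ε ∈ Ω} L_π(z+ε,v)`. -/
noncomputable def Lmax (S : Data n m q) (p : Vec n × Vec m) : ℝ :=
  sSup ((fun ε => S.Lπ (p.1 + ε, p.2)) '' S.Ω)

/-- `ℓ` is one of the three stage costs `L_π`, `L_π^int`, `L_π^max`. -/
def IsStageCost (S : Data n m q) (ℓ : Vec n × Vec m → ℝ) : Prop :=
  ℓ = S.Lπ ∨ ℓ = S.Lint ∨ ℓ = S.Lmax

/-! ### Nominal trajectories and optimal control problems without terminal conditions -/

/-- `(z,v)` is an admissible nominal state-input pair over the horizon `N`. -/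
def IsAdmissible (S : Data n m q) (N : ℕ) (z : ℕ → Vec n) (v : ℕ → Vec m) : Prop :=
  ∀ t < N, z (t + 1) = S.F (z t) (v t) ∧ (z t, v t) ∈ S.Zbar

/-- `(z,v)` is an admissible nominal state-input pair over the infinite horizon. -/
def IsAdmissibleInf (S : Data n m q) (z : ℕ → Vec n) (v : ℕ → Vec m) : Prop :=
  ∀ t, z (t + 1) = S.F (z t) (v t) ∧ (z t, v t) ∈ S.Zbar

/-- `𝕏_∞`: initial states that admit an admissible infinite-horizon trajectory. -/
def XInf (S : Data n m q) : Set (Vec n) := {z₀ | ∃ z v, z 0 = z₀ ∧ S.IsAdmissibleInf z v}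

end Data

/-- Accumulated cost `J_N = ∑_{t<N} c(z(t),v(t))` along a state-input sequence. -/
noncomputable def cost {n m : ℕ} (c : Vec n × Vec m → ℝ) (N : ℕ)
    (z : ℕ → Vec n) (v : ℕ → Vec m) : ℝ :=
  ∑ t ∈ Finset.range N, c (z t, v t)

/-- `J_∞ = limsup_{N → ∞} J_N`, in the extended reals. -/
noncomputable def costInf {n m : ℕ} (c : Vec n × Vec m → ℝ)
    (z : ℕ → Vec n) (v : ℕ → Vec m) : EReal :=
  limsup (fun N : ℕ => ((cost c N z v : ℝ) : EReal)) atTop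

namespace Data

variable {n m q : ℕ}

/-- Finite-horizon optimal value `V_N(z₀)` (no terminal conditions); `⊤` if infeasible. -/
noncomputable def V (S : Data n m q) (c : Vec n × Vec m → ℝ) (N : ℕ) (z₀ : Vec n) : EReal :=
  sInf {r | ∃ z v, z 0 = z₀ ∧ S.IsAdmissible N z v ∧ r = ((cost c N z v : ℝ) : EReal)}

/-- Infinite-horizon optimal value `V_∞(z₀)`; `⊤` if infeasible. -/
noncomputable def VInf (S : Data n m q) (c : Vec n × Vec m → ℝ) (z₀ : Vec n) : EReal :=
  sInf {r | ∃ z v, z 0 = z₀ ∧ S.IsAdmissibleInf z v ∧ r = costInf c z v}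

/-- `(z,v)` is a minimizer of the horizon-`N` problem with initial state `z₀`. -/
def IsOptimal (S : Data n m q) (c : Vec n × Vec m → ℝ) (N : ℕ) (z₀ : Vec n)
    (z : ℕ → Vec n) (v : ℕ → Vec m) : Prop :=
  z 0 = z₀ ∧ S.IsAdmissible N z v ∧ ((cost c N z v : ℝ) : EReal) = S.V c N z₀

/-- `z₀` is a (feasible) minimizer of `V_N` over all `z₀` with `x ∈ {z₀} ⊕ Ω`. -/
def IsOptimalInit (S : Data n m q) (c : Vec n × Vec m → ℝ) (N : ℕ) (x z₀ : Vec n) : Prop :=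
  x - z₀ ∈ S.Ω ∧ S.V c N z₀ ≠ ⊤ ∧ ∀ z', x - z' ∈ S.Ω → S.V c N z₀ ≤ S.V c N z'

/-- `z(0),…,z(T)` with inputs `v(0),…,v(T-1)` is a closed-loop nominal sequence up to time `T`
of the tube-based MPC scheme with horizon `N`: each `v(t)` is the first element of an optimal
input sequence at `z(t)`, and `z(t+1)` is an optimal initial nominal state for some real state
in `{f_π(z(t),v(t),0)} ⊕ Ω`. -/
def IsClosedLoop (S : Data n m q) (c : Vec n × Vec m → ℝ) (N T : ℕ)
    (z : ℕ → Vec n) (v : ℕ → Vec m) : Prop :=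
  ∀ t < T,
    (∃ zo vo, S.IsOptimal c N (z t) zo vo ∧ vo 0 = v t) ∧
    ∃ x : Vec n, x - S.F (z t) (v t) ∈ S.Ω ∧ S.IsOptimalInit c N x (z (t + 1))

/-! ### Assumptions on the steady state -/

/-- `(zs,vs)` is a robust optimal steady state: it minimizes `ℓ` over all nominal steady states
in the tightened constraint set. -/
def IsROSS (S : Data n m q) (ℓ : Vec n × Vec m → ℝ) (zs : Vec n) (vs : Vec m) : Prop :=
  (zs, vs) ∈ S.Zbar ∧ zs = S.F zs vs ∧
    ∀ z v, (z, v) ∈ S.Zbar → z = S.F z v → ℓ (zs, vs) ≤ ℓ (z, v)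

/-- Strict dissipativity of the nominal system with supply rate `ℓ - ℓ(zs,vs)` and a bounded
storage function. -/
def IsStrictlyDissipative (S : Data n m q) (ℓ : Vec n × Vec m → ℝ)
    (zs : Vec n) (vs : Vec m) : Prop :=
  ∃ (α : ℝ≥0 → ℝ≥0) (lam : Vec n → ℝ), IsClassKInf α ∧ (∃ B : ℝ, ∀ z, |lam z| ≤ B) ∧
    ∀ z v, (z, v) ∈ S.Zbar →
      lam (S.F z v) - lam z ≤ ℓ (z, v) - ℓ (zs, vs) - (α ‖(z, v) - (zs, vs)‖₊ : ℝ)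

/-- Exponential reachability of `(zs,vs)` from `𝕏_∞` by admissible trajectories. -/
def IsExpReachable (S : Data n m q) (zs : Vec n) (vs : Vec m) : Prop :=
  ∃ C r : ℝ, 0 ≤ C ∧ 0 ≤ r ∧ r < 1 ∧ ∀ z₀ ∈ S.XInf, ∃ z v, z 0 = z₀ ∧ S.IsAdmissibleInf z v ∧
    ∀ k, ‖(z k, v k) - (zs, vs)‖ ≤ C * r ^ k

/-- Local `M`-step controllability at the equilibrium `(zs,vs)`: states near `zs` can be steered to
each other in `M` steps, with states and inputs staying near `(zs,vs)`. -/
def IsLocallyControllable (S : Data n m q) (M : ℕ) (zs : Vec n) (vs : Vec m) : Prop :=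
  ∀ ε > (0 : ℝ), ∃ δ > (0 : ℝ), ∀ y y' : Vec n, ‖y - zs‖ < δ → ‖y' - zs‖ < δ →
    ∃ (z : ℕ → Vec n) (v : ℕ → Vec m), z 0 = y ∧ z M = y' ∧
      (∀ t < M, z (t + 1) = S.F (z t) (v t) ∧ ‖v t - vs‖ < ε) ∧
      ∀ t ≤ M, ‖z t - zs‖ < ε

/-- The optimal value functions are continuous at `zs`, uniformly in the horizon:
`|V_N(z) - V_N(zs)| ≤ α(‖z - zs‖)` for all `N` and all `z ∈ 𝕏_∞`. -/
def HasValueContinuity (S : Data n m q) (c : Vec n × Vec m → ℝ) (zs : Vec n) : Prop :=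
  ∃ α : ℝ≥0 → ℝ≥0, IsClassKInf α ∧ ∀ (N : ℕ), ∀ z ∈ S.XInf,
    S.V c N z ≤ S.V c N zs + (((α ‖z - zs‖₊ : ℝ≥0) : ℝ) : EReal) ∧
    S.V c N zs ≤ S.V c N z + (((α ‖z - zs‖₊ : ℝ≥0) : ℝ) : EReal)

end Data

/-- The stage cost normalized to vanish at the steady state: `ℓ - ℓ(zs,vs)`. -/
def shifted {n m : ℕ} (ℓ : Vec n × Vec m → ℝ) (zs : Vec n) (vs : Vec m) :
    Vec n × Vec m → ℝ :=
  fun p => ℓ p - ℓ (zs, vs)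

end TubeEMPC

namespace TubeEMPC

/-! Summing the strict dissipation inequality telescopes the bounded storage function: along an
admissible trajectory, the sum of `α` of the distance to the steady state is at most the cost plus a
constant. A trajectory of bounded cost therefore comes close to `zs` before a time independent of
its horizon (`exists_near`). By reachability, cost bounds hold uniformly on `𝕏_∞`, so near-optimal
trajectories have this turnpike property.

Cut such a trajectory at its visit to a neighbourhood of `zs` and exchange the tail for a tail of
the other problem. Near `zs`, `V_k` is close to `V_k(zs)` by assumption and `V_∞` is close to
`V_∞(zs)` by cheap local transitions. Since `V_k(zs)` decreases to a limit `C`, the difference `V_N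
- V_∞` tends to the constant `κ = C - V_∞(zs)`, uniformly on `𝕏_∞`
(`exists_forall_abs_toReal_V_sub_le`).

In closed loop, optimality gives stage cost at most `V_N(z(t)) - V_{N-1}(F)`, where `F` is the
nominal successor. As `F` is itself a candidate for the next nominal state, `V_N(z(t+1)) ≤ V_N(F)`.
Replacing every `V` by `V_∞ + κ` cancels `κ` and leaves a telescoping sum with a small error per
step (`exists_forall_cost_le`). A crude constant error serves every `N ≥ 1` (`cost_le_of_bound`),
and `exists_isClassL_of_eventually` merges the two bounds into a class `𝓛` function. -/

/-! ### Class `𝓛` majorants -/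

/-- A family of bounds that is valid with a fixed constant for all `N ≥ 1` and with arbitrarily
small constants for large `N` is valid with a class `𝓛` function of `N`. -/
theorem exists_isClassL_of_eventually {P : ℕ → ℝ → Prop} {D : ℝ} (hD : 0 < D)
    (hmono : ∀ N a b, a ≤ b → P N a → P N b) (hbdd : ∀ N, 1 ≤ N → P N D)
    (hsmall : ∀ η > 0, ∃ N₁, ∀ N, N₁ ≤ N → P N η) :
    ∃ δ : ℝ≥0 → ℝ≥0, IsClassL δ ∧ ∀ N : ℕ, 1 ≤ N → P N (δ (N : ℝ≥0)) := by
  have hpos : ∀ k : ℕ, 0 < D * (1 / 2) ^ k := fun k => by positivity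
  choose n hn using fun k : ℕ => hsmall (D * (1 / 2) ^ (k + 1)) (hpos _)
  set a : ℕ → ℝ := fun k => n k + 1 with ha
  have ha0 : ∀ k, 0 < a k := fun k => by positivity
  -- The candidate is `∑ g k`. The term `g k` is decreasing and still at least `D / 2 ^ k` for `t <
  -- n k`, that is, before the next smaller constant becomes available; the geometric factor makes
  -- the series converge uniformly.
  set g : ℕ → ℝ≥0 → ℝ := fun k t => D * (1 / 2) ^ k * (2 * (a k / (a k + t))) with hg
  have hden : ∀ k (t : ℝ≥0), 0 < a k + (t : ℝ) := fun k t =>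
    add_pos_of_pos_of_nonneg (ha0 k) t.2
  have hg0 : ∀ k t, 0 < g k t := fun k t =>
    mul_pos (hpos k) (mul_pos two_pos (div_pos (ha0 k) (hden k t)))
  have hgle : ∀ k t, ‖g k t‖ ≤ D * (1 / 2) ^ k * 2 := fun k t => by
    rw [Real.norm_of_nonneg (hg0 k t).le]
    refine mul_le_mul_of_nonneg_left ?_ (hpos k).le
    have : a k / (a k + t) ≤ 1 := (div_le_one (hden k t)).2 (by simp)
    linarith
  have hsum : Summable fun k : ℕ => D * (1 / 2 : ℝ) ^ k * 2 :=
    (summable_geometric_two.mul_left D).mul_right 2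
  have hgsum : ∀ t, Summable fun k => g k t := fun t =>
    Summable.of_norm_bounded hsum fun k => hgle k t
  have hanti : ∀ k, StrictAnti (g k) := fun k s t hst => by
    refine mul_lt_mul_of_pos_left ?_ (hpos k)
    refine mul_lt_mul_of_pos_left ?_ two_pos
    exact div_lt_div_of_pos_left (ha0 k) (hden k s) (by simpa using hst)
  have hgcont : ∀ k, Continuous (g k) := fun k => by
    refine continuous_const.mul (continuous_const.mul ?_)
    exact continuous_const.div (continuous_const.add NNReal.continuous_coe)
      fun t => (hden k t).ne'
  have hglim : ∀ k, Tendsto (g k) atTop (𝓝 0) := fun k => by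
    have h1 : Tendsto (fun t : ℝ≥0 => a k + (t : ℝ)) atTop atTop :=
      tendsto_atTop_add_const_left _ _ (NNReal.tendsto_coe_atTop.2 tendsto_id)
    have h2 := ((h1.const_div_atTop (a k)).const_mul 2).const_mul (D * (1 / 2) ^ k)
    simpa only [mul_zero] using h2
  have hδ0 : ∀ t, 0 < ∑' k, g k t := fun t =>
    (hgsum t).tsum_pos (fun k => (hg0 k t).le) 0 (hg0 0 t)
  refine ⟨fun t => Real.toNNReal (∑' k, g k t), ⟨?_, ?_, ?_⟩, ?_⟩
  · exact continuous_real_toNNReal.comp (continuous_tsum hgcont hsum hgle)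
  · intro s t hst
    refine (Real.toNNReal_lt_toNNReal_iff (hδ0 s)).2 ?_
    exact Summable.tsum_lt_tsum (fun k => (hanti k hst).le) (hanti 0 hst) (hgsum t) (hgsum s)
  · have := tendsto_tsum_of_dominated_convergence (𝓕 := atTop) (f := fun t k => g k t)
      (g := fun _ => 0) hsum hglim (Eventually.of_forall fun t k => hgle k t)
    simpa using tendsto_real_toNNReal this
  · intro N hN
    rw [Real.coe_toNNReal _ (hδ0 _).le]
    set d : ℝ := ∑' k, g k N with hd
    change P N d
    by_contra hP
    -- If `P N d` failed, `d` would lie below every level: were `d` at least the level `k + 1`, then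
    -- `N < n k`, so the summand `g k N` alone would push `d` up to the level `k`, against the
    -- induction hypothesis. This forces `d ≤ 0`.
    have key : ∀ k, d < D * (1 / 2) ^ k := by
      intro k
      induction k with
      | zero =>
        by_contra h
        exact hP (hmono N D d (by simpa using h) (hbdd N hN))
      | succ k ih =>
        by_contra! h
        have hNn : N < n k := by
          by_contra! hle
          exact hP (hmono N _ _ h (hn k N hle))
        have h1 : g k N ≤ d := (hgsum N).le_tsum k fun j _ => (hg0 j N).le
        have h2 : D * (1 / 2) ^ k * 1 ≤ g k N := by
          refine mul_le_mul_of_nonneg_left ?_ (hpos k).le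
          have h3 : (1 / 2 : ℝ) ≤ a k / (a k + (N : ℝ≥0)) := by
            rw [div_le_div_iff₀ two_pos (hden k N)]
            have : (N : ℝ) < n k := by exact_mod_cast hNn
            simp only [ha, NNReal.coe_natCast]
            linarith
          linarith
        linarith
    have hlim : Tendsto (fun k : ℕ => D * (1 / 2 : ℝ) ^ k) atTop (𝓝 0) := by
      simpa using (tendsto_pow_atTop_nhds_zero_of_lt_one (by norm_num : (0 : ℝ) ≤ 1 / 2)
        (by norm_num)).const_mul D
    exact absurd (ge_of_tendsto' hlim fun k => (key k).le) (not_le.2 (hδ0 N))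

/-! ### Operations on trajectories -/

section Trajectories

variable {n m q : ℕ} {S : Data n m q} {c : Vec n × Vec m → ℝ}

/-- Follow the first sequence up to time `P`, the second one afterwards. -/
def concat {β : Type*} (P : ℕ) (x y : ℕ → β) (t : ℕ) : β := if t < P then x t else y (t - P)

theorem concat_of_lt {β : Type*} {P t : ℕ} (x y : ℕ → β) (h : t < P) : concat P x y t = x t :=
  if_pos h

theorem concat_add {β : Type*} (P t : ℕ) (x y : ℕ → β) : concat P x y (P + t) = y t := by
  simp [concat]

theorem concat_zero {β : Type*} {P : ℕ} {x y : ℕ → β} (h : x P = y 0) :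
    concat P x y 0 = x 0 := by
  rcases Nat.eq_zero_or_pos P with rfl | hP
  · simpa [concat] using h.symm
  · exact concat_of_lt x y hP

theorem cost_add (c : Vec n × Vec m → ℝ) (P k : ℕ) (z : ℕ → Vec n) (v : ℕ → Vec m) :
    cost c (P + k) z v
      = cost c P z v + cost c k (fun t => z (P + t)) (fun t => v (P + t)) :=
  Finset.sum_range_add _ _ _

theorem cost_concat (c : Vec n × Vec m → ℝ) (P k : ℕ) (z z' : ℕ → Vec n) (v v' : ℕ → Vec m) :
    cost c (P + k) (concat P z z') (concat P v v') = cost c P z v + cost c k z' v' := by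
  rw [cost_add]
  congr 1
  · exact Finset.sum_congr rfl fun t ht => by
      rw [concat_of_lt _ _ (Finset.mem_range.1 ht), concat_of_lt _ _ (Finset.mem_range.1 ht)]
  · simp only [concat_add]

theorem Data.IsAdmissible.mono {P N : ℕ} {z : ℕ → Vec n} {v : ℕ → Vec m}
    (h : S.IsAdmissible N z v) (hP : P ≤ N) : S.IsAdmissible P z v :=
  fun t ht => h t (ht.trans_le hP)

theorem Data.IsAdmissibleInf.isAdmissible {z : ℕ → Vec n} {v : ℕ → Vec m}
    (h : S.IsAdmissibleInf z v) (N : ℕ) : S.IsAdmissible N z v :=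
  fun t _ => h t

theorem Data.IsAdmissible.shift {P k : ℕ} {z : ℕ → Vec n} {v : ℕ → Vec m}
    (h : S.IsAdmissible (P + k) z v) :
    S.IsAdmissible k (fun t => z (P + t)) (fun t => v (P + t)) :=
  fun t ht => h (P + t) (by omega)

theorem Data.IsAdmissibleInf.shift {z : ℕ → Vec n} {v : ℕ → Vec m}
    (h : S.IsAdmissibleInf z v) (P : ℕ) :
    S.IsAdmissibleInf (fun t => z (P + t)) (fun t => v (P + t)) :=
  fun t => h (P + t)

theorem Data.IsAdmissible.concat {P k : ℕ} {z z' : ℕ → Vec n} {v v' : ℕ → Vec m}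
    (h : S.IsAdmissible P z v) (h' : S.IsAdmissible k z' v') (hz : z P = z' 0) :
    S.IsAdmissible (P + k) (concat P z z') (concat P v v') := by
  intro t ht
  rcases lt_or_ge t P with htP | htP
  · rw [concat_of_lt z z' htP, concat_of_lt v v' htP]
    refine ⟨?_, (h t htP).2⟩
    rw [← (h t htP).1]
    rcases (Nat.succ_le_of_lt htP).lt_or_eq with h1 | h1
    · exact concat_of_lt z z' h1
    -- At the junction the spliced sequence already reads the second trajectory, so `hz` is what
    -- makes the dynamics match.
    · have : t + 1 = P + 0 := by omega
      rw [this, concat_add, add_zero, hz]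
  · obtain ⟨s, rfl⟩ := Nat.exists_eq_add_of_le htP
    rw [add_assoc, concat_add, concat_add, concat_add]
    exact h' s (by omega)

theorem Data.IsAdmissible.concatInf {P : ℕ} {z z' : ℕ → Vec n} {v v' : ℕ → Vec m}
    (h : S.IsAdmissible P z v) (h' : S.IsAdmissibleInf z' v') (hz : z P = z' 0) :
    S.IsAdmissibleInf (TubeEMPC.concat P z z') (TubeEMPC.concat P v v') :=
  fun t => h.concat (h'.isAdmissible (t + 1)) hz t (by omega)

theorem Data.mem_XInf_of_isAdmissible {P : ℕ} {z : ℕ → Vec n} {v : ℕ → Vec m}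
    (h : S.IsAdmissible P z v) (hz : z P ∈ S.XInf) : z 0 ∈ S.XInf := by
  obtain ⟨z', v', h0, h'⟩ := hz
  exact ⟨_, _, concat_zero h0.symm, h.concatInf h' h0.symm⟩

theorem Data.IsAdmissibleInf.mem_XInf {z : ℕ → Vec n} {v : ℕ → Vec m}
    (h : S.IsAdmissibleInf z v) (P : ℕ) : z P ∈ S.XInf :=
  ⟨_, _, rfl, h.shift P⟩

theorem Data.V_le_cost {N : ℕ} {z : ℕ → Vec n} {v : ℕ → Vec m} (h : S.IsAdmissible N z v) :
    S.V c N (z 0) ≤ (cost c N z v : ℝ) :=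
  sInf_le ⟨z, v, rfl, h, rfl⟩

theorem Data.exists_cost_lt_of_V_lt {N : ℕ} {x : Vec n} {a : ℝ} (h : S.V c N x < (a : EReal)) :
    ∃ z v, z 0 = x ∧ S.IsAdmissible N z v ∧ cost c N z v < a := by
  obtain ⟨_, ⟨z, v, h0, h1, rfl⟩, hlt⟩ := sInf_lt_iff.1 h
  exact ⟨z, v, h0, h1, EReal.coe_lt_coe_iff.1 hlt⟩

theorem Data.VInf_le_of_eventually {z : ℕ → Vec n} {v : ℕ → Vec m} {a : ℝ}
    (h : S.IsAdmissibleInf z v) (ha : ∀ᶠ N in atTop, cost c N z v ≤ a) :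
    S.VInf c (z 0) ≤ (a : EReal) :=
  sInf_le_of_le ⟨z, v, rfl, h, rfl⟩ <|
    limsup_le_of_le (h := ha.mono fun _ hN => EReal.coe_le_coe_iff.2 hN)

theorem Data.exists_cost_lt_of_VInf_lt {x : Vec n} {a : ℝ} (h : S.VInf c x < (a : EReal)) :
    ∃ z v, z 0 = x ∧ S.IsAdmissibleInf z v ∧ ∀ᶠ N in atTop, cost c N z v < a := by
  obtain ⟨_, ⟨z, v, h0, h1, rfl⟩, hlt⟩ := sInf_lt_iff.1 h
  exact ⟨z, v, h0, h1, (eventually_lt_of_limsup_lt hlt).mono fun _ hN =>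
    EReal.coe_lt_coe_iff.1 hN⟩

end Trajectories

/-! ### Turnpike estimates -/

/-- The consequences of dissipativity, reachability and controllability on which the performance
estimate rests: bounds `-B` and `Q` for the cost, with `α` of the distance to the steady state
summing up to at most `B` plus the cost, and cheap transitions between states near `zs`. -/
structure HasTurnpike {n m q : ℕ} (S : Data n m q) (c : Vec n × Vec m → ℝ)
    (zs : Vec n) (vs : Vec m) (α : ℝ≥0 → ℝ≥0) (B Q : ℝ) : Prop where
  mem_Zbar : (zs, vs) ∈ S.Zbar
  steady : zs = S.F zs vs
  cost_steady : c (zs, vs) = 0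
  strictMono : StrictMono α
  sum_le : ∀ N z v, S.IsAdmissible N z v →
    ∑ t ∈ Finset.range N, (α ‖(z t, v t) - (zs, vs)‖₊ : ℝ) ≤ cost c N z v + B
  exists_cost_le : ∀ x ∈ S.XInf, ∃ z v, z 0 = x ∧ S.IsAdmissibleInf z v ∧
    ∀ N, cost c N z v ≤ Q
  transition : ∀ ω > (0 : ℝ), ∃ ρ > (0 : ℝ), ∀ y y' : Vec n, ‖y - zs‖ < ρ → ‖y' - zs‖ < ρ →
    ∃ k z v, z 0 = y ∧ z k = y' ∧ S.IsAdmissible k z v ∧ cost c k z v ≤ ω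

namespace HasTurnpike

variable {n m q : ℕ} {S : Data n m q} {c : Vec n × Vec m → ℝ} {zs : Vec n} {vs : Vec m}
  {α : ℝ≥0 → ℝ≥0} {B Q : ℝ}

theorem isAdmissibleInf_const (h : HasTurnpike S c zs vs α B Q) :
    S.IsAdmissibleInf (fun _ => zs) (fun _ => vs) :=
  fun _ => ⟨h.steady, h.mem_Zbar⟩

theorem mem_XInf (h : HasTurnpike S c zs vs α B Q) : zs ∈ S.XInf :=
  h.isAdmissibleInf_const.mem_XInf 0

theorem neg_le_cost (h : HasTurnpike S c zs vs α B Q) {N : ℕ} {z : ℕ → Vec n} {v : ℕ → Vec m}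
    (hz : S.IsAdmissible N z v) : -B ≤ cost c N z v := by
  have h1 := h.sum_le N z v hz
  have h2 : 0 ≤ ∑ t ∈ Finset.range N, (α ‖(z t, v t) - (zs, vs)‖₊ : ℝ) :=
    Finset.sum_nonneg fun _ _ => NNReal.coe_nonneg _
  linarith

/-- Trajectories of low cost visit every neighbourhood of the steady state early on. -/
theorem exists_near (h : HasTurnpike S c zs vs α B Q) {ρ R : ℝ} (hρ : 0 < ρ) :
    ∃ P : ℕ, ∀ N, P ≤ N → ∀ z v, S.IsAdmissible N z v → cost c N z v ≤ R →
      ∃ k, 1 ≤ k ∧ k < P ∧ ‖z k - zs‖ < ρ := by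
  lift ρ to ℝ≥0 using hρ.le
  have hα : (0 : ℝ) < α ρ := by
    exact_mod_cast zero_le.trans_lt (h.strictMono (by exact_mod_cast hρ : (0 : ℝ≥0) < ρ))
  -- If all times `1, …, p` were at distance at least `ρ`, the sum would be at least `p * α ρ > R +
  -- B`. Time `0` is left out so that the visit also lies ahead of `z 1`.
  obtain ⟨p, hp⟩ := exists_nat_gt ((R + B) / α ρ)
  rw [div_lt_iff₀ hα] at hp
  refine ⟨p + 1, fun N hN z v hz hR => ?_⟩
  by_contra! hfar
  have h1 := h.sum_le N z v hz
  have h2 : ∑ t ∈ Finset.Ico 1 (p + 1), (α ρ : ℝ)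
      ≤ ∑ t ∈ Finset.range N, (α ‖(z t, v t) - (zs, vs)‖₊ : ℝ) := by
    refine (Finset.sum_le_sum fun t ht => ?_).trans
      (Finset.sum_le_sum_of_subset_of_nonneg (fun t ht => ?_)
        fun _ _ _ => NNReal.coe_nonneg _)
    · obtain ⟨h3, h4⟩ := Finset.mem_Ico.1 ht
      refine NNReal.coe_le_coe.2 (h.strictMono.monotone ?_)
      rw [← NNReal.coe_le_coe, coe_nnnorm]
      exact (hfar t h3 h4).trans (norm_fst_le ((z t, v t) - (zs, vs)))
    · have := Finset.mem_Ico.1 ht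
      exact Finset.mem_range.2 (by omega)
  rw [Finset.sum_const, Nat.card_Ico, nsmul_eq_mul, Nat.add_sub_cancel] at h2
  linarith

theorem exists_near_mem_XInf (h : HasTurnpike S c zs vs α B Q) :
    ∃ ρ > (0 : ℝ), ∀ y, ‖y - zs‖ < ρ → y ∈ S.XInf := by
  obtain ⟨ρ, hρ, H⟩ := h.transition 1 one_pos
  refine ⟨ρ, hρ, fun y hy => ?_⟩
  obtain ⟨k, z, v, h0, h1, hz, -⟩ := H y zs hy (by simpa using hρ)
  rw [← h0]
  exact Data.mem_XInf_of_isAdmissible hz (h1 ▸ h.mem_XInf)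

/-! ### Finiteness of the value functions and dynamic programming inequalities -/

theorem neg_le_V (h : HasTurnpike S c zs vs α B Q) (N : ℕ) (x : Vec n) :
    ((-B : ℝ) : EReal) ≤ S.V c N x := by
  refine le_sInf ?_
  rintro _ ⟨z, v, -, hz, rfl⟩
  exact EReal.coe_le_coe_iff.2 (h.neg_le_cost hz)

theorem neg_le_VInf (h : HasTurnpike S c zs vs α B Q) (x : Vec n) :
    ((-B : ℝ) : EReal) ≤ S.VInf c x := by
  refine le_sInf ?_
  rintro _ ⟨z, v, -, hz, rfl⟩
  refine le_limsup_of_frequently_le (Frequently.of_forall fun N => ?_)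
  exact EReal.coe_le_coe_iff.2 (h.neg_le_cost (hz.isAdmissible N))

theorem V_le (h : HasTurnpike S c zs vs α B Q) (N : ℕ) {x : Vec n} (hx : x ∈ S.XInf) :
    S.V c N x ≤ (Q : EReal) := by
  obtain ⟨z, v, rfl, hz, hQ⟩ := h.exists_cost_le x hx
  exact (Data.V_le_cost (hz.isAdmissible N)).trans (EReal.coe_le_coe_iff.2 (hQ N))

theorem VInf_le (h : HasTurnpike S c zs vs α B Q) {x : Vec n} (hx : x ∈ S.XInf) :
    S.VInf c x ≤ (Q : EReal) := by
  obtain ⟨z, v, rfl, hz, hQ⟩ := h.exists_cost_le x hx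
  exact Data.VInf_le_of_eventually hz (Eventually.of_forall hQ)

theorem VInf_ne_bot (h : HasTurnpike S c zs vs α B Q) (x : Vec n) : S.VInf c x ≠ ⊥ :=
  ((EReal.bot_lt_coe _).trans_le (h.neg_le_VInf x)).ne'

theorem VInf_ne_top (h : HasTurnpike S c zs vs α B Q) {x : Vec n} (hx : x ∈ S.XInf) :
    S.VInf c x ≠ ⊤ :=
  ((h.VInf_le hx).trans_lt (EReal.coe_lt_top _)).ne

theorem coe_toReal_V (h : HasTurnpike S c zs vs α B Q) (N : ℕ) {x : Vec n} (hx : x ∈ S.XInf) :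
    ((S.V c N x).toReal : EReal) = S.V c N x :=
  EReal.coe_toReal ((h.V_le N hx).trans_lt (EReal.coe_lt_top _)).ne
    ((EReal.bot_lt_coe _).trans_le (h.neg_le_V N x)).ne'

theorem coe_toReal_VInf (h : HasTurnpike S c zs vs α B Q) {x : Vec n} (hx : x ∈ S.XInf) :
    ((S.VInf c x).toReal : EReal) = S.VInf c x :=
  EReal.coe_toReal (h.VInf_ne_top hx) (h.VInf_ne_bot x)

theorem toReal_V_le (h : HasTurnpike S c zs vs α B Q) (N : ℕ) {x : Vec n} (hx : x ∈ S.XInf) :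
    (S.V c N x).toReal ≤ Q := by
  rw [← EReal.coe_le_coe_iff, h.coe_toReal_V N hx]
  exact h.V_le N hx

theorem neg_le_toReal_V (h : HasTurnpike S c zs vs α B Q) (N : ℕ) {x : Vec n}
    (hx : x ∈ S.XInf) : -B ≤ (S.V c N x).toReal := by
  rw [← EReal.coe_le_coe_iff, h.coe_toReal_V N hx]
  exact h.neg_le_V N x

theorem toReal_VInf_le (h : HasTurnpike S c zs vs α B Q) {x : Vec n} (hx : x ∈ S.XInf) :
    (S.VInf c x).toReal ≤ Q := by
  rw [← EReal.coe_le_coe_iff, h.coe_toReal_VInf hx]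
  exact h.VInf_le hx

theorem neg_le_toReal_VInf (h : HasTurnpike S c zs vs α B Q) {x : Vec n}
    (hx : x ∈ S.XInf) : -B ≤ (S.VInf c x).toReal := by
  rw [← EReal.coe_le_coe_iff, h.coe_toReal_VInf hx]
  exact h.neg_le_VInf x

theorem toReal_V_le_cost (h : HasTurnpike S c zs vs α B Q) {N : ℕ} {z : ℕ → Vec n}
    {v : ℕ → Vec m} (hz : S.IsAdmissible N z v) (hx : z 0 ∈ S.XInf) :
    (S.V c N (z 0)).toReal ≤ cost c N z v := by
  rw [← EReal.coe_le_coe_iff, h.coe_toReal_V N hx]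
  exact Data.V_le_cost hz

theorem exists_cost_lt_toReal_V (h : HasTurnpike S c zs vs α B Q) (N : ℕ) {x : Vec n}
    (hx : x ∈ S.XInf) {ε : ℝ} (hε : 0 < ε) :
    ∃ z v, z 0 = x ∧ S.IsAdmissible N z v ∧ cost c N z v < (S.V c N x).toReal + ε := by
  refine Data.exists_cost_lt_of_V_lt ?_
  rw [← h.coe_toReal_V N hx, EReal.coe_lt_coe_iff, EReal.toReal_coe]
  linarith

theorem exists_cost_lt_toReal_VInf (h : HasTurnpike S c zs vs α B Q) {x : Vec n}
    (hx : x ∈ S.XInf) {ε : ℝ} (hε : 0 < ε) :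
    ∃ z v, z 0 = x ∧ S.IsAdmissibleInf z v ∧
      ∀ᶠ N in atTop, cost c N z v < (S.VInf c x).toReal + ε := by
  refine Data.exists_cost_lt_of_VInf_lt ?_
  rw [← h.coe_toReal_VInf hx, EReal.coe_lt_coe_iff, EReal.toReal_coe]
  linarith

theorem toReal_VInf_le_of_eventually (h : HasTurnpike S c zs vs α B Q) {z : ℕ → Vec n}
    {v : ℕ → Vec m} {a : ℝ} (hz : S.IsAdmissibleInf z v)
    (ha : ∀ᶠ N in atTop, cost c N z v ≤ a) : (S.VInf c (z 0)).toReal ≤ a := by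
  rw [← EReal.coe_le_coe_iff, h.coe_toReal_VInf (hz.mem_XInf 0)]
  exact Data.VInf_le_of_eventually hz ha

/-- One half of the dynamic programming principle for finite horizons. -/
theorem toReal_V_add_le (h : HasTurnpike S c zs vs α B Q) {P : ℕ} (k : ℕ) {z : ℕ → Vec n}
    {v : ℕ → Vec m} (hz : S.IsAdmissible P z v) (hx : z P ∈ S.XInf) :
    (S.V c (P + k) (z 0)).toReal ≤ cost c P z v + (S.V c k (z P)).toReal := by
  refine le_of_forall_pos_le_add fun ε hε => ?_
  obtain ⟨z', v', h0, hz', hlt⟩ := h.exists_cost_lt_toReal_V k hx hε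
  have h1 := h.toReal_V_le_cost (hz.concat hz' h0.symm)
    (by rw [concat_zero h0.symm]; exact Data.mem_XInf_of_isAdmissible hz hx)
  rw [concat_zero h0.symm, cost_concat] at h1
  linarith

/-- One half of the dynamic programming principle for the infinite horizon. -/
theorem toReal_VInf_le_cost_add (h : HasTurnpike S c zs vs α B Q) {P : ℕ} {z : ℕ → Vec n}
    {v : ℕ → Vec m} (hz : S.IsAdmissible P z v) (hx : z P ∈ S.XInf) :
    (S.VInf c (z 0)).toReal ≤ cost c P z v + (S.VInf c (z P)).toReal := by
  refine le_of_forall_pos_le_add fun ε hε => ?_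
  obtain ⟨z', v', h0, hz', hlt⟩ := h.exists_cost_lt_toReal_VInf hx hε
  have h1 := h.toReal_VInf_le_of_eventually (hz.concatInf hz' h0.symm)
    (a := cost c P z v + ((S.VInf c (z P)).toReal + ε)) (by
      obtain ⟨N₀, hN₀⟩ := eventually_atTop.1 hlt
      refine eventually_atTop.2 ⟨P + N₀, fun N hN => ?_⟩
      obtain ⟨k, rfl⟩ := Nat.exists_eq_add_of_le (le_of_add_le_left hN)
      rw [cost_concat]
      linarith [hN₀ k (by omega)])
  rw [concat_zero h0.symm] at h1
  linarith

/-- The converse half of dynamic programming: the tail of the trajectory competes for `V_∞(z P)`. -/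
theorem cost_add_toReal_VInf_le (h : HasTurnpike S c zs vs α B Q) (P : ℕ) {z : ℕ → Vec n}
    {v : ℕ → Vec m} {a : ℝ} (hz : S.IsAdmissibleInf z v)
    (ha : ∀ᶠ N in atTop, cost c N z v ≤ a) :
    cost c P z v + (S.VInf c (z P)).toReal ≤ a := by
  have h1 := h.toReal_VInf_le_of_eventually (hz.shift P) (a := a - cost c P z v) (by
    obtain ⟨N₀, hN₀⟩ := eventually_atTop.1 ha
    refine eventually_atTop.2 ⟨N₀, fun k hk => ?_⟩
    have := hN₀ (P + k) (by omega)
    rw [cost_add] at this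
    linarith)
  rw [add_zero] at h1
  linarith

theorem cost_add_toReal_V_le (h : HasTurnpike S c zs vs α B Q) {P k : ℕ} {z : ℕ → Vec n}
    {v : ℕ → Vec m} (hz : S.IsAdmissible (P + k) z v) (hx : z P ∈ S.XInf) :
    cost c P z v + (S.V c k (z P)).toReal ≤ cost c (P + k) z v := by
  rw [cost_add]
  have := h.toReal_V_le_cost hz.shift (by simpa using hx)
  rw [add_zero] at this
  linarith

/-- `V_∞` is continuous at `zs`. -/
theorem exists_abs_toReal_VInf_sub_le (h : HasTurnpike S c zs vs α B Q) {ω : ℝ} (hω : 0 < ω) :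
    ∃ ρ > (0 : ℝ), ∀ y, ‖y - zs‖ < ρ → y ∈ S.XInf ∧
      |(S.VInf c y).toReal - (S.VInf c zs).toReal| ≤ ω := by
  obtain ⟨ρ₁, hρ₁, H₁⟩ := h.exists_near_mem_XInf
  obtain ⟨ρ₂, hρ₂, H₂⟩ := h.transition ω hω
  refine ⟨min ρ₁ ρ₂, lt_min hρ₁ hρ₂, fun y hy => ?_⟩
  have hy1 := H₁ y (hy.trans_le (min_le_left _ _))
  have hy2 := hy.trans_le (min_le_right ρ₁ ρ₂)
  have hs : ‖zs - zs‖ < ρ₂ := by simpa using hρ₂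
  -- Steer from `a` to `b` at cost at most `ω`, then continue almost optimally; using this in both
  -- directions gives the absolute value.
  have key : ∀ a b, ‖a - zs‖ < ρ₂ → ‖b - zs‖ < ρ₂ → b ∈ S.XInf →
      (S.VInf c a).toReal ≤ ω + (S.VInf c b).toReal := by
    intro a b ha hb hbX
    obtain ⟨k, z, v, rfl, rfl, hz, hc⟩ := H₂ a b ha hb
    have := h.toReal_VInf_le_cost_add hz hbX
    linarith
  refine ⟨hy1, abs_sub_le_iff.2 ⟨?_, ?_⟩⟩
  · linarith [key y zs hy2 hs h.mem_XInf]
  · linarith [key zs y hs hy2 hy1]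

/-- Waiting at `zs` first costs nothing, so a longer horizon cannot be worse there. -/
theorem antitone_toReal_V_steady (h : HasTurnpike S c zs vs α B Q) :
    Antitone fun N => (S.V c N zs).toReal := by
  intro k N hkN
  obtain ⟨P, rfl⟩ := Nat.exists_eq_add_of_le' hkN
  have := h.toReal_V_add_le k (h.isAdmissibleInf_const.isAdmissible P) h.mem_XInf
  simpa [cost, h.cost_steady] using this

/-- Up to a constant, `V_N` converges to `V_∞` uniformly on `𝕏_∞`. -/
theorem exists_forall_abs_toReal_V_sub_le (h : HasTurnpike S c zs vs α B Q)
    (hcont : S.HasValueContinuity c zs) :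
    ∃ κ : ℝ, ∀ η > (0 : ℝ), ∃ N₁ : ℕ, ∀ N, N₁ ≤ N → ∀ x ∈ S.XInf,
      |(S.V c N x).toReal - (S.VInf c x).toReal - κ| ≤ η := by
  obtain ⟨β, ⟨hβc, -, hβ0, -⟩, hβ⟩ := hcont
  have hlim := tendsto_atTop_ciInf h.antitone_toReal_V_steady
    ⟨-B, by rintro _ ⟨N, rfl⟩; exact h.neg_le_toReal_V N h.mem_XInf⟩
  set C : ℝ := ⨅ N, (S.V c N zs).toReal with hC
  have hCle : ∀ N, C ≤ (S.V c N zs).toReal := fun N =>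
    h.antitone_toReal_V_steady.le_of_tendsto hlim N
  refine ⟨C - (S.VInf c zs).toReal, fun η hη => ?_⟩
  -- The upper estimate spends `ω` four times: near-optimality, continuity of `V_∞`, continuity of
  -- `V_k`, and `V_k(zs) < C + ω`. The lower one needs only three, because `C ≤ V_k(zs)` is exact.
  set ω : ℝ := η / 4 with hω
  have hω0 : 0 < ω := by positivity
  obtain ⟨ρ₁, hρ₁, H₁⟩ := h.exists_abs_toReal_VInf_sub_le hω0
  obtain ⟨ρ₂, hρ₂, H₂⟩ : ∃ ρ > (0 : ℝ), ∀ y : Vec n, ‖y - zs‖ < ρ →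
      ((β ‖y - zs‖₊ : ℝ≥0) : ℝ) < ω := by
    have h1 : Continuous fun y : Vec n => ((β ‖y - zs‖₊ : ℝ≥0) : ℝ) := by fun_prop
    have h2 := h1.tendsto zs
    simp only [sub_self, nnnorm_zero, hβ0, NNReal.coe_zero] at h2
    obtain ⟨ρ, hρ, H⟩ := Metric.eventually_nhds_iff.1 (h2.eventually (gt_mem_nhds hω0))
    exact ⟨ρ, hρ, fun y hy => H (by rwa [dist_eq_norm])⟩
  have hV : ∀ k y, y ∈ S.XInf → ‖y - zs‖ < ρ₂ →
      |(S.V c k y).toReal - (S.V c k zs).toReal| ≤ ω := by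
    intro k y hyX hy
    obtain ⟨h1, h2⟩ := hβ k y hyX
    rw [← h.coe_toReal_V k hyX, ← h.coe_toReal_V k h.mem_XInf, ← EReal.coe_add,
      EReal.coe_le_coe_iff] at h1 h2
    have := H₂ y hy
    exact abs_sub_le_iff.2 ⟨by linarith, by linarith⟩
  obtain ⟨P, hP⟩ := h.exists_near (R := Q + ω) (lt_min hρ₁ hρ₂)
  obtain ⟨N₂, hN₂⟩ := eventually_atTop.1
    (hlim.eventually (gt_mem_nhds (lt_add_of_pos_right C hω0)))
  -- The visit occurs before time `P`, so the remaining horizon `k` is at least `N₂`.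
  refine ⟨P + N₂, fun N hN x hx => abs_le.2 ⟨?_, ?_⟩⟩
  · obtain ⟨z, v, rfl, hz, hlt⟩ := h.exists_cost_lt_toReal_V N hx hω0
    obtain ⟨p, -, hpP, hp⟩ := hP N (by omega) z v hz
      (hlt.le.trans (by linarith [h.toReal_V_le N hx]))
    obtain ⟨k, rfl⟩ := Nat.exists_eq_add_of_le (show p ≤ N by omega)
    obtain ⟨hpX, hpV⟩ := H₁ (z p) (hp.trans_le (min_le_left _ _))
    have h1 := h.cost_add_toReal_V_le hz hpX
    have h2 := h.toReal_VInf_le_cost_add (hz.mono (by omega)) hpX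
    have h3 := abs_le.1 (hV k (z p) hpX (hp.trans_le (min_le_right _ _)))
    have h4 := abs_le.1 hpV
    have h5 := hCle k
    linarith [h3.1, h4.2]
  · obtain ⟨z, v, rfl, hz, hev⟩ := h.exists_cost_lt_toReal_VInf hx hω0
    -- `N'` is an auxiliary truncation at which the cost is already below its eventual bound; it
    -- serves only to locate the visit.
    obtain ⟨N', hN'P, hN'⟩ := ((eventually_ge_atTop P).and hev).exists
    obtain ⟨p, -, hpP, hp⟩ := hP N' hN'P z v (hz.isAdmissible N')
      (hN'.le.trans (by linarith [h.toReal_VInf_le hx]))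
    obtain ⟨k, rfl⟩ := Nat.exists_eq_add_of_le (show p ≤ N by omega)
    obtain ⟨hpX, hpV⟩ := H₁ (z p) (hp.trans_le (min_le_left _ _))
    have h1 := h.cost_add_toReal_VInf_le p hz (hev.mono fun _ => le_of_lt)
    have h2 := h.toReal_V_add_le k (hz.isAdmissible p) hpX
    have h3 := abs_le.1 (hV k (z p) hpX (hp.trans_le (min_le_right _ _)))
    have h4 := abs_le.1 hpV
    have h5 := hN₂ k (by omega)
    linarith [h3.2, h4.1]

/-! ### Closed-loop sequences -/

/-- For long horizons, states with a bounded finite value lie in `𝕏_∞`, and so do the successors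
along trajectories of bounded cost. -/
theorem exists_forall_mem_XInf (h : HasTurnpike S c zs vs α B Q) (R : ℝ) :
    ∃ N₀ : ℕ, ∀ N, N₀ ≤ N → ∀ z v, S.IsAdmissible N z v → cost c N z v ≤ R →
      z 0 ∈ S.XInf ∧ z 1 ∈ S.XInf := by
  obtain ⟨ρ, hρ, H⟩ := h.exists_near_mem_XInf
  obtain ⟨P, hP⟩ := h.exists_near (R := R) hρ
  refine ⟨P, fun N hN z v hz hR => ?_⟩
  obtain ⟨k, hk, hkP, hnear⟩ := hP N hN z v hz hR
  have hX := H _ hnear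
  obtain ⟨j, rfl⟩ := Nat.exists_eq_add_of_le hk
  refine ⟨Data.mem_XInf_of_isAdmissible (hz.mono (by omega)) hX, ?_⟩
  exact Data.mem_XInf_of_isAdmissible (P := j)
    (Data.IsAdmissible.shift (P := 1) (hz.mono (by omega))) hX

/-- One step of the closed loop with a long horizon: the nominal successor and the next nominal
state both lie in `𝕏_∞`. -/
theorem exists_forall_step_mem_XInf (h : HasTurnpike S c zs vs α B Q) :
    ∃ N₀ : ℕ, 1 ≤ N₀ ∧ ∀ N, N₀ ≤ N → ∀ T z v, S.IsClosedLoop c N T z v → ∀ t < T,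
      z t ∈ S.XInf → S.F (z t) (v t) ∈ S.XInf ∧ z (t + 1) ∈ S.XInf := by
  obtain ⟨N₀, hN₀⟩ := h.exists_forall_mem_XInf (Q + 1)
  refine ⟨N₀ + 1, by omega, fun N hN T z v hcl t ht hzt => ?_⟩
  obtain ⟨⟨zo, vo, ⟨h0, hadm, hopt⟩, hv⟩, x, hx, -, -, hmin⟩ := hcl t ht
  have hF : S.F (z t) (v t) ∈ S.XInf := by
    have hle : cost c N zo vo ≤ Q + 1 := by
      have := h.V_le N hzt
      rw [← hopt, EReal.coe_le_coe_iff] at this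
      linarith
    have := (hN₀ N (by omega) zo vo hadm hle).2
    rwa [(hadm 0 (by omega)).1, h0, hv] at this
  refine ⟨hF, ?_⟩
  -- By `hx` the nominal successor competes in the choice of `z (t + 1)`. The slack `1` yields a
  -- trajectory of cost below `Q + 1` without assuming a minimizer.
  have hlt : S.V c N (z (t + 1)) < ((Q + 1 : ℝ) : EReal) :=
    ((hmin _ hx).trans (h.V_le N hF)).trans_lt (EReal.coe_lt_coe_iff.2 (by linarith))
  obtain ⟨z', v', h0', hadm', hlt'⟩ := Data.exists_cost_lt_of_V_lt hlt
  exact h0' ▸ (hN₀ N (by omega) z' v' hadm' hlt'.le).1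

theorem exists_forall_closedLoop_mem_XInf (h : HasTurnpike S c zs vs α B Q) :
    ∃ N₀ : ℕ, 1 ≤ N₀ ∧ ∀ N, N₀ ≤ N → ∀ T z v, S.IsClosedLoop c N T z v → z 0 ∈ S.XInf →
      ∀ t ≤ T, z t ∈ S.XInf := by
  obtain ⟨N₀, h1, hN₀⟩ := h.exists_forall_step_mem_XInf
  refine ⟨N₀, h1, fun N hN T z v hcl h0 t => ?_⟩
  induction t with
  | zero => exact fun _ => h0
  | succ t ih => exact fun ht => (hN₀ N hN T z v hcl t (by omega) (ih (by omega))).2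

/-- Performance estimate for long horizons, with an arbitrarily small error per time step. -/
theorem exists_forall_cost_le (h : HasTurnpike S c zs vs α B Q)
    (hcont : S.HasValueContinuity c zs) {η : ℝ} (hη : 0 < η) :
    ∃ N₁ : ℕ, ∀ N, N₁ ≤ N → ∀ T z v, S.IsClosedLoop c N T z v → z 0 ∈ S.XInf →
      cost c T z v ≤ (S.VInf c (z 0)).toReal - (S.VInf c (z T)).toReal + T * η := by
  obtain ⟨κ, hκ⟩ := h.exists_forall_abs_toReal_V_sub_le hcont
  obtain ⟨N₁, hN₁⟩ := hκ (η / 4) (by positivity)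
  obtain ⟨N₂, hN₂, hstep⟩ := h.exists_forall_step_mem_XInf
  refine ⟨N₁ + N₂ + 1, fun N hN T z v hcl h0 => ?_⟩
  have hone : ∀ t < T, z t ∈ S.XInf →
      c (z t, v t) ≤ (S.VInf c (z t)).toReal - (S.VInf c (z (t + 1))).toReal + η := by
    intro t ht hzt
    obtain ⟨hF, hnext⟩ := hstep N (by omega) T z v hcl t ht hzt
    obtain ⟨⟨zo, vo, ⟨ho, hadm, hopt⟩, hv⟩, x, hx, -, -, hmin⟩ := hcl t ht
    obtain ⟨k, rfl⟩ := Nat.exists_eq_add_of_le (show 1 ≤ N by omega)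
    have h1 : zo 1 = S.F (z t) (v t) := by rw [(hadm 0 (by omega)).1, ho, hv]
    have hc1 : cost c 1 zo vo = c (z t, v t) := by simp [cost, ho, hv]
    have h2 := h.cost_add_toReal_V_le hadm (by rwa [h1])
    rw [h1, hc1] at h2
    rw [← h.coe_toReal_V _ hzt, EReal.coe_eq_coe_iff] at hopt
    have h3 := hmin _ hx
    rw [← h.coe_toReal_V _ hnext, ← h.coe_toReal_V _ hF, EReal.coe_le_coe_iff] at h3
    -- The successor is compared at both horizons: `k` for the optimal tail and `1 + k` for the
    -- choice of the next state. The four errors of `η / 4` add up to `η`, and `κ` cancels.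
    have e1 := abs_le.1 (hN₁ (1 + k) (by omega) _ hzt)
    have e2 := abs_le.1 (hN₁ k (by omega) _ hF)
    have e3 := abs_le.1 (hN₁ (1 + k) (by omega) _ hnext)
    have e4 := abs_le.1 (hN₁ (1 + k) (by omega) _ hF)
    linarith [e1.2, e2.1, e3.1, e4.2]
  have hind : ∀ t ≤ T, z t ∈ S.XInf ∧
      cost c t z v ≤ (S.VInf c (z 0)).toReal - (S.VInf c (z t)).toReal + t * η := by
    intro t
    induction t with
    | zero => exact fun _ => ⟨h0, by simp [cost]⟩
    | succ t ih =>
      intro ht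
      obtain ⟨hX, hle⟩ := ih (by omega)
      refine ⟨(hstep N (by omega) T z v hcl t (by omega) hX).2, ?_⟩
      have h1 := hone t (by omega) hX
      have h2 : cost c (t + 1) z v = cost c t z v + c (z t, v t) := Finset.sum_range_succ _ _
      rw [h2]
      push_cast
      linarith
  exact (hind T le_rfl).2

/-- Performance estimate for all horizons, with a constant error per time step. -/
theorem cost_le_of_bound (h : HasTurnpike S c zs vs α B Q) {D : ℝ}
    (hD : ∀ p ∈ S.Zbar, c p ≤ D) (hBQ : 0 ≤ B + Q) {N : ℕ} (hN : 1 ≤ N) {T : ℕ}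
    {z : ℕ → Vec n} {v : ℕ → Vec m} (hcl : S.IsClosedLoop c N T z v) (h0 : z 0 ∈ S.XInf)
    (hT : z T ∈ S.XInf) :
    cost c T z v ≤ (S.VInf c (z 0)).toReal - (S.VInf c (z T)).toReal + T * (D + B + Q) := by
  rcases Nat.eq_zero_or_pos T with rfl | hTpos
  · simp [cost]
  · have h1 : cost c T z v ≤ T * D := by
      have := Finset.sum_le_card_nsmul (Finset.range T) (fun t => c (z t, v t)) D fun t ht => by
        obtain ⟨⟨zo, vo, ⟨ho, hadm, -⟩, hv⟩, -⟩ := hcl t (Finset.mem_range.1 ht)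
        have := (hadm 0 (by omega)).2
        rw [ho, hv] at this
        exact hD _ this
      simpa [cost] using this
    have h2 := h.neg_le_toReal_VInf h0
    have h3 := h.toReal_VInf_le hT
    -- The difference of the `V_∞` values is at least `-(B + Q)`; since `T ≥ 1`, this one-time
    -- deficit fits into the error per step.
    have h4 : (1 : ℝ) * (B + Q) ≤ T * (B + Q) :=
      mul_le_mul_of_nonneg_right (by exact_mod_cast hTpos) hBQ
    linarith

end HasTurnpike

/-! ### The tube-based setting -/

section Tube

variable {n m q : ℕ} {S : Data n m q} {ℓ : Vec n × Vec m → ℝ} {zs : Vec n} {vs : Vec m}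

/-- The stage costs are bounded on the tightened constraint set. -/
theorem Data.IsStageCost.exists_bound (hℓ : S.IsStageCost ℓ) (hZ : IsCompact S.Z)
    (hΩ : IsCompact S.Ω) (hsub : S.Zbar ⊆ S.Zπ) (hL : Continuous S.L) :
    ∃ D : ℝ, ∀ p ∈ S.Zbar, ℓ p ≤ D := by
  obtain ⟨b, hb⟩ := hZ.exists_bound_of_continuousOn hL.continuousOn
  -- No continuity of `π` is needed, as `(x, π(x,v))` stays in the compact set `S.Z`. The maximum
  -- with `0` covers the value `0` of `sSup` on the empty set.
  have hπ : ∀ p ∈ S.Zπ, ‖S.Lπ p‖ ≤ max b 0 := fun p hp => (hb _ hp).trans (le_max_left _ _)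
  rcases hℓ with rfl | rfl | rfl
  · exact ⟨max b 0, fun p hp => (le_abs_self _).trans (hπ p (hsub hp))⟩
  · refine ⟨max b 0 * volume.real S.Ω, fun p hp => (le_abs_self _).trans ?_⟩
    exact norm_setIntegral_le_of_norm_le_const hΩ.measure_lt_top fun ε hε => hπ _ (hp ε hε)
  · refine ⟨max b 0, fun p hp => Real.sSup_le ?_ (le_max_right _ _)⟩
    rintro _ ⟨ε, hε, rfl⟩
    exact (le_abs_self _).trans (hπ _ (hp ε hε))

/-- The storage terms telescope, and each of the two end values contributes at most `B`. -/
theorem sum_le_cost_shifted_add {α : ℝ≥0 → ℝ≥0} {lam : Vec n → ℝ} {B : ℝ}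
    (hB : ∀ z, |lam z| ≤ B)
    (hd : ∀ z v, (z, v) ∈ S.Zbar →
      lam (S.F z v) - lam z ≤ ℓ (z, v) - ℓ (zs, vs) - (α ‖(z, v) - (zs, vs)‖₊ : ℝ))
    {N : ℕ} {z : ℕ → Vec n} {v : ℕ → Vec m} (hz : S.IsAdmissible N z v) :
    ∑ t ∈ Finset.range N, (α ‖(z t, v t) - (zs, vs)‖₊ : ℝ)
      ≤ cost (shifted ℓ zs vs) N z v + 2 * B := by
  have h1 : ∑ t ∈ Finset.range N, (α ‖(z t, v t) - (zs, vs)‖₊ : ℝ)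
      ≤ ∑ t ∈ Finset.range N,
        (shifted ℓ zs vs (z t, v t) - (lam (z (t + 1)) - lam (z t))) := by
    refine Finset.sum_le_sum fun t ht => ?_
    obtain ⟨h2, h3⟩ := hz t (Finset.mem_range.1 ht)
    have := hd _ _ h3
    rw [h2]
    simp only [shifted]
    linarith
  rw [Finset.sum_sub_distrib, Finset.sum_range_sub (fun t => lam (z t))] at h1
  have h2 := abs_le.1 (hB (z 0))
  have h3 := abs_le.1 (hB (z N))
  simp only [cost]
  linarith [h2.2, h3.1]

theorem abs_shifted_le {K : ℝ≥0} (hK : LipschitzOnWith K ℓ S.Zπ) (hsub : S.Zbar ⊆ S.Zπ)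
    (hs : (zs, vs) ∈ S.Zbar) {p : Vec n × Vec m} (hp : p ∈ S.Zbar) :
    |shifted ℓ zs vs p| ≤ K * ‖p - (zs, vs)‖ := by
  have := hK.dist_le_mul p (hsub hp) _ (hsub hs)
  rwa [Real.dist_eq, dist_eq_norm] at this

/-- Exponential convergence and the Lipschitz bound dominate the cost by a geometric series that
depends on neither `x` nor `N`. -/
theorem exists_cost_shifted_le {K : ℝ≥0} (hK : LipschitzOnWith K ℓ S.Zπ)
    (hsub : S.Zbar ⊆ S.Zπ) (hs : (zs, vs) ∈ S.Zbar) (hreach : S.IsExpReachable zs vs) :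
    ∃ Q : ℝ, 0 ≤ Q ∧ ∀ x ∈ S.XInf, ∃ z v, z 0 = x ∧ S.IsAdmissibleInf z v ∧
      ∀ N, cost (shifted ℓ zs vs) N z v ≤ Q := by
  obtain ⟨C, r, hC, hr0, hr1, H⟩ := hreach
  refine ⟨∑' k : ℕ, K * (C * r ^ k), tsum_nonneg fun k => by positivity, fun x hx => ?_⟩
  obtain ⟨z, v, h0, hz, hle⟩ := H x hx
  refine ⟨z, v, h0, hz, fun N => ?_⟩
  have hsum : Summable fun k : ℕ => (K : ℝ) * (C * r ^ k) :=
    ((summable_geometric_of_lt_one hr0 hr1).mul_left C).mul_left _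
  refine (Finset.sum_le_sum fun t _ => ?_).trans
    (hsum.sum_le_tsum (Finset.range N) fun k _ => by positivity)
  exact (le_abs_self _).trans ((abs_shifted_le hK hsub hs (hz t).2).trans
    (mul_le_mul_of_nonneg_left (hle t) K.2))

theorem exists_transition {K : ℝ≥0} {M : ℕ} (hK : LipschitzOnWith K ℓ S.Zπ)
    (hsub : S.Zbar ⊆ S.Zπ) (hint : (zs, vs) ∈ interior S.Zbar)
    (hctrl : S.IsLocallyControllable M zs vs) {ω : ℝ} (hω : 0 < ω) :
    ∃ ρ > (0 : ℝ), ∀ y y' : Vec n, ‖y - zs‖ < ρ → ‖y' - zs‖ < ρ →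
      ∃ k z v, z 0 = y ∧ z k = y' ∧ S.IsAdmissible k z v ∧
        cost (shifted ℓ zs vs) k z v ≤ ω := by
  obtain ⟨ε₁, hε₁, hball⟩ := Metric.mem_nhds_iff.1 (mem_interior_iff_mem_nhds.1 hint)
  have hMK : (0 : ℝ) < M * K + 1 := by positivity
  -- The radius `ε₁` keeps the transition inside `S.Zbar`; the other one bounds the cost of `M`
  -- steps by `ω`, with `+ 1` guarding against `M * K = 0`.
  obtain ⟨ρ, hρ, H⟩ := hctrl (min ε₁ (ω / (M * K + 1))) (lt_min hε₁ (by positivity))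
  refine ⟨ρ, hρ, fun y y' hy hy' => ?_⟩
  obtain ⟨z, v, h0, hM, hstep, hnear⟩ := H y y' hy hy'
  have hdist : ∀ t < M, ‖(z t, v t) - (zs, vs)‖ < min ε₁ (ω / (M * K + 1)) := fun t ht => by
    rw [Prod.mk_sub_mk, Prod.norm_mk]
    exact max_lt (hnear t ht.le) (hstep t ht).2
  have hadm : S.IsAdmissible M z v := fun t ht => ⟨(hstep t ht).1, hball (by
    rw [Metric.mem_ball, dist_eq_norm]
    exact (hdist t ht).trans_le (min_le_left _ _))⟩
  refine ⟨M, z, v, h0, hM, hadm, ?_⟩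
  have h1 := Finset.sum_le_card_nsmul (Finset.range M) (fun t => shifted ℓ zs vs (z t, v t))
    (K * (ω / (M * K + 1))) fun t ht => by
      have ht' := Finset.mem_range.1 ht
      exact (le_abs_self _).trans ((abs_shifted_le hK hsub (interior_subset hint)
        (hadm t ht').2).trans (mul_le_mul_of_nonneg_left
          ((hdist t ht').le.trans (min_le_right _ _)) K.2))
  rw [Finset.card_range, nsmul_eq_mul] at h1
  refine h1.trans ?_
  have h2 : (M : ℝ) * (K * (ω / (M * K + 1))) = ω * (M * K) / (M * K + 1) := by ring
  rw [h2, div_le_iff₀ hMK]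
  linarith

end Tube

end TubeEMPC

theorem mainTheorem4 {n m q : ℕ} (S : TubeEMPC.Data n m q)
    (ℓ : TubeEMPC.Vec n × TubeEMPC.Vec m → ℝ)
    (zs : TubeEMPC.Vec n) (vs : TubeEMPC.Vec m) (M : ℕ)
    -- constraint and disturbance sets
    (hZ : IsCompact S.Z ∧ Convex ℝ S.Z ∧ (interior S.Z).Nonempty)
    (hW : IsCompact S.W ∧ Convex ℝ S.W ∧ (0 : TubeEMPC.Vec q) ∈ interior S.W)
    -- robust control invariant set
    (hRCI : S.IsRCI)
    (hΩ : (interior S.Ω).Nonempty)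
    (hZbar : (interior S.Zbar).Nonempty)
    (hZbarZπ : S.Zbar ⊆ S.Zπ)
    -- stage cost
    (hL : Continuous S.L)
    (hℓ : S.IsStageCost ℓ)
    (hLip : ∃ K : NNReal, LipschitzOnWith K ℓ S.Zπ)
    -- robust optimal steady state
    (hROSS : S.IsROSS ℓ zs vs)
    (hint : (zs, vs) ∈ interior S.Zbar)
    (hreach : S.IsExpReachable zs vs)
    (hctrl : S.IsLocallyControllable M zs vs)
    (hdiss : S.IsStrictlyDissipative ℓ zs vs)
    (hcont : S.HasValueContinuity (TubeEMPC.shifted ℓ zs vs) zs) :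
    (∀ z₀ ∈ S.XInf, S.VInf (TubeEMPC.shifted ℓ zs vs) z₀ ≠ ⊥ ∧
      S.VInf (TubeEMPC.shifted ℓ zs vs) z₀ ≠ ⊤) ∧
    ∃ δ₃ : NNReal → NNReal, TubeEMPC.IsClassL δ₃ ∧
      (∀ N : ℕ, 1 ≤ N → ∀ (T : ℕ) (z : ℕ → TubeEMPC.Vec n) (v : ℕ → TubeEMPC.Vec m),
        S.IsClosedLoop (TubeEMPC.shifted ℓ zs vs) N T z v → z 0 ∈ S.XInf → z T ∈ S.XInf →
        ((TubeEMPC.cost (TubeEMPC.shifted ℓ zs vs) T z v : ℝ) : EReal) ≤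
          S.VInf (TubeEMPC.shifted ℓ zs vs) (z 0) - S.VInf (TubeEMPC.shifted ℓ zs vs) (z T)
            + (((T : ℝ) * (δ₃ (N : NNReal) : ℝ) : ℝ) : EReal)) ∧
      ∃ N₀ : ℕ, ∀ N : ℕ, N₀ ≤ N →
        ∀ (T : ℕ) (z : ℕ → TubeEMPC.Vec n) (v : ℕ → TubeEMPC.Vec m),
        S.IsClosedLoop (TubeEMPC.shifted ℓ zs vs) N T z v → z 0 ∈ S.XInf →
        ∀ t ≤ T, z t ∈ S.XInf := by
  obtain ⟨K, hK⟩ := hLip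
  obtain ⟨α, lam, hα, ⟨B, hB⟩, hd⟩ := hdiss
  have hs := hROSS.1
  obtain ⟨Q, hQ0, hQ⟩ := TubeEMPC.exists_cost_shifted_le hK hZbarZπ hs hreach
  have hB0 : 0 ≤ B := (abs_nonneg _).trans (hB 0)
  have h : TubeEMPC.HasTurnpike S (TubeEMPC.shifted ℓ zs vs) zs vs α (2 * B) Q :=
    { mem_Zbar := hs
      steady := hROSS.2.1
      cost_steady := sub_self _
      strictMono := hα.2.1
      sum_le := fun _ _ _ hz => TubeEMPC.sum_le_cost_shifted_add hB hd hz
      exists_cost_le := hQ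
      transition := fun _ hω => TubeEMPC.exists_transition hK hZbarZπ hint hctrl hω }
  obtain ⟨D, hD⟩ := hℓ.exists_bound hZ.1 hRCI.1 hZbarZπ hL
  -- The absolute value and `+ 1` make the constant strictly positive, as the class `𝓛` construction
  -- requires.
  have hD' : ∀ p ∈ S.Zbar, TubeEMPC.shifted ℓ zs vs p ≤ |D - ℓ (zs, vs)| + 1 := fun p hp => by
    have h1 := hD p hp
    have h2 := le_abs_self (D - ℓ (zs, vs))
    simp only [TubeEMPC.shifted]
    linarith
  refine ⟨fun x hx => ⟨h.VInf_ne_bot x, h.VInf_ne_top hx⟩, ?_⟩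
  obtain ⟨δ, hδ, hP⟩ := TubeEMPC.exists_isClassL_of_eventually
    (P := fun N η => ∀ (T : ℕ) (z : ℕ → TubeEMPC.Vec n) (v : ℕ → TubeEMPC.Vec m),
      S.IsClosedLoop (TubeEMPC.shifted ℓ zs vs) N T z v → z 0 ∈ S.XInf → z T ∈ S.XInf →
      TubeEMPC.cost (TubeEMPC.shifted ℓ zs vs) T z v ≤
        (S.VInf (TubeEMPC.shifted ℓ zs vs) (z 0)).toReal
          - (S.VInf (TubeEMPC.shifted ℓ zs vs) (z T)).toReal + T * η)
    (D := |D - ℓ (zs, vs)| + 1 + 2 * B + Q) (by positivity)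
    (fun N a b hab hPa T z v hcl h0 hT => by
      have h1 := hPa T z v hcl h0 hT
      have h2 : (T : ℝ) * a ≤ T * b := mul_le_mul_of_nonneg_left hab T.cast_nonneg
      linarith)
    (fun N hN T z v hcl h0 hT =>
      h.cost_le_of_bound hD' (by positivity) hN hcl h0 hT)
    (fun η hη => by
      obtain ⟨N₁, hN₁⟩ := h.exists_forall_cost_le hcont hη
      exact ⟨N₁, fun N hN T z v hcl h0 _ => hN₁ N hN T z v hcl h0⟩)
  refine ⟨δ, hδ, fun N hN T z v hcl h0 hT => ?_, ?_⟩
  · rw [← h.coe_toReal_VInf h0, ← h.coe_toReal_VInf hT, ← EReal.coe_sub, ← EReal.coe_add,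
      EReal.coe_le_coe_iff]
    exact hP N hN T z v hcl h0 hT
  · obtain ⟨N₀, -, hN₀⟩ := h.exists_forall_closedLoop_mem_XInf
    exact ⟨N₀, hN₀⟩
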